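/- For a positive integer $n$ let $T(n)=n(n+1)/2$, and let $\mathcal T(n)$ be the triangular graph: its vertices are the $T(n)$ pairs $(i,j)$ of integers with $1\le j\le i\le n$, and two distinct vertices $(i,j)$ and $(k,\ell)$ are adjacent if and only if $i=k$, or $j=\ell$, or $i-j=k-\ell$. Let $\sigma(G)$ denote the spectrum of a graph $G$, that is, the multiset of eigenvalues of its adjacency matrix, counted with multiplicity; $\lambda^{[m]}$ means that $\lambda$ occurs with multiplicity $m$, and eigenvalues written without exponent are simple. A graph is integral if all its eigenvalues are integers. For $n\in\{1,2\}$, $\mathcal T(n)$ is isomorphic to the complete graph on $T(n)$ vertices ($K_1$ and $K_3$, respectively). For $n=3$, $\sigma(\mathcal T(3))=\{4,\,0^{[3]},\,(-2)^{[2]}\}$. For every $n\ge 4$, $\mathcal T(n)$ is integral, and its spectrum is as follows. 1. If $n$ is odd, then $\sigma(\mathcal T(n))$ consists of the simple eigenvalue $2n-2$; every integer $\lambda$ with $\frac{n-3}{2}\le\lambda\le n-3$, with multiplicity $3$; $\frac{n-7}{2}$ with multiplicity $2$; every integer $\lambda$ with $-2\le\lambda\le\frac{n-9}{2}$, with multiplicity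 $3$; and $-3$ with multiplicity $T(n-3)$. (In particular $\frac{n-5}{2}$ is not an eigenvalue.) 2. If $n$ is even, then $\sigma(\mathcal T(n))$ consists of the simple eigenvalue $2n-2$; every integer $\lambda$ with $\frac{n-2}{2}\le\lambda\le n-3$, with multiplicity $3$; $\frac{n-4}{2}$ with multiplicity $2$; every integer $\lambda$ with $-2\le\lambda\le\frac{n-8}{2}$, with multiplicity $3$; and $-3$ with multiplicity $T(n-3)$. (In particular $\frac{n-6}{2}$ is not an eigenvalue.) -/

import Mathlib

/-- The `n`-th triangular number `T(n) = n(n+1)/2`. -/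
def triangularNumber (n : ℕ) : ℕ := n * (n + 1) / 2

/-- The triangular board with `n` rows: the points `(i, j)` with `1 ≤ i ≤ n` and `1 ≤ j ≤ i`. -/
def triangularBoard (n : ℕ) : Finset (ℕ × ℕ) :=
  (Finset.Icc 1 n ×ˢ Finset.Icc 1 n).filter (fun p => p.2 ≤ p.1)

/-- The triangular graph: its vertices are the points of the triangular board, and two distinct
points are adjacent when they lie in the same row, the same column or the same diagonal. -/
def triangularGraph (n : ℕ) : SimpleGraph (triangularBoard n) where
  Adj u v :=
    (u.1.1 = v.1.1 ∨ u.1.2 = v.1.2 ∨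
      (u.1.1 : ℤ) - (u.1.2 : ℤ) = (v.1.1 : ℤ) - (v.1.2 : ℤ)) ∧ u ≠ v
  symm := ⟨fun _ _ h =>
    ⟨h.1.imp Eq.symm (fun h' => h'.imp Eq.symm Eq.symm), h.2.symm⟩⟩
  loopless := ⟨fun _ h => h.2 rfl⟩

instance triangularGraph.decidableAdj (n : ℕ) : DecidableRel (triangularGraph n).Adj :=
  fun u v => inferInstanceAs (Decidable
    ((u.1.1 = v.1.1 ∨ u.1.2 = v.1.2 ∨
      (u.1.1 : ℤ) - (u.1.2 : ℤ) = (v.1.1 : ℤ) - (v.1.2 : ℤ)) ∧ u ≠ v))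

/-- The spectrum of a finite graph: the multiset of the eigenvalues of its (real symmetric)
adjacency matrix, as roots of the characteristic polynomial counted with multiplicity. -/
noncomputable def graphSpectrum {V : Type*} [Fintype V] [DecidableEq V]
    (G : SimpleGraph V) [DecidableRel G.Adj] : Multiset ℝ :=
  (G.adjMatrix ℝ).charpoly.roots

/-- A finite graph is integral if all its eigenvalues are integers. -/
def IsIntegralGraph {V : Type*} [Fintype V] [DecidableEq V]
    (G : SimpleGraph V) [DecidableRel G.Adj] : Prop :=
  ∀ μ ∈ graphSpectrum G, ∃ k : ℤ, μ = (k : ℝ)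

/-- The multiset that contains every integer of the interval `[a, b]`, each `m` times, viewed
in the reals. -/
noncomputable def integerRange (m : ℕ) (a b : ℤ) : Multiset ℝ :=
  m • (Finset.Icc a b).val.map (fun k : ℤ => (k : ℝ))

/-!
Two distinct points of the board lie on at most one common line, so with `N` the incidence matrix of
the `3 * n` lines against the points, the adjacency matrix is `Nᵀ * N - 3`.  Its spectrum therefore
follows from that of `N * Nᵀ`, a matrix of size `3 * n`.

A line is determined by its direction and its length `a ∈ {1, …, n}`.  The three lines through a
point have lengths `a, b, c` with `a + b + c = 2 * n + 1`, and every such triple comes from exactly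
one point.  Hence lines of lengths `a`, `b` in different directions meet if and only if
`a + b ≥ n + 1`, whichever the directions, and
`N * Nᵀ = D ⊗ 1 + B ⊗ (J - 1)` with `D = diag(1, …, n)`, `B = (1 if a + b ≥ n + 1)` and `J` the
all-ones matrix of size three (`lineIncidence_mul_transpose`).  Diagonalizing `J - 1` turns this into
one block `D + 2 * B` and two blocks `D - B` (`charpoly_kronecker_three`).

Both blocks have explicit eigenvectors with integer eigenvalues
(`mem_roots_sub_overlap`, `mem_roots_add_overlap`, `two_mul_add_one_mem_roots_add_overlap`).  A vector
is described by its tail sums `F`, since `B` maps it to `a ↦ F (n + 1 - a)`: for the eigenvalue `k`,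
the function `F` is supported between `k` and `n + 1 - k`, and it is linear there for `D - B`,
quadratic for `D + 2 * B`.  The block `D - B` gets the eigenvalues `0, …, n` without
`⌊(n + 1) / 2⌋`, and `D + 2 * B` gets `2 * n + 1` and `0, …, n` without `⌊n / 2⌋` and `⌊n / 2⌋ + 1`.
These are `n` distinct numbers in either case, so nothing else occurs.  The eigenvalue with
multiplicity `2`, and the gap next to it, come from the difference between the two lists near `n / 2`.
-/

open Matrix Polynomial

/-! ### Lines of the board and their incidences -/

/-- The length of the line through the point `p` of the `n`-th board in the `s`-th of the three
directions (`0` for rows, `1` for columns, `2` for diagonals).  On the board the three lengths lie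
between `1` and `n`, they sum to `2 * n + 1`, and a line is determined by its direction and length;
the truncated subtractions are exact there. -/
def lineLength (n : ℕ) (s : Fin 3) (p : ℕ × ℕ) : ℕ :=
  ![p.1, n + 1 - p.2, n - p.1 + p.2] s

lemma mem_triangularBoard {n : ℕ} {p : ℕ × ℕ} :
    p ∈ triangularBoard n ↔ 1 ≤ p.2 ∧ p.2 ≤ p.1 ∧ p.1 ≤ n := by
  simp only [triangularBoard, Finset.mem_filter, Finset.mem_product, Finset.mem_Icc]
  omega

lemma lineLength_mem {n : ℕ} (p : triangularBoard n) (s : Fin 3) :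
    1 ≤ lineLength n s p ∧ lineLength n s p ≤ n := by
  have := mem_triangularBoard.1 p.2
  fin_cases s <;> simp [lineLength] <;> omega

lemma lineLength_sum {n : ℕ} (p : triangularBoard n) :
    lineLength n 0 p + lineLength n 1 p + lineLength n 2 p = 2 * n + 1 := by
  have := mem_triangularBoard.1 p.2
  simp [lineLength]
  omega

/-- Two points that share their lines in two different directions coincide. -/
lemma eq_of_lineLength_eq {n : ℕ} {p q : triangularBoard n} {s t : Fin 3} (hst : s ≠ t)
    (hs : lineLength n s p = lineLength n s q) (ht : lineLength n t p = lineLength n t q) :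
    p = q := by
  have hp := mem_triangularBoard.1 p.2
  have hq := mem_triangularBoard.1 q.2
  apply Subtype.ext
  apply Prod.ext <;>
  fin_cases s <;> fin_cases t <;> simp [lineLength] at hst hs ht <;> omega

/-- Every triple of lengths with the right sum is realized by a point. -/
lemma exists_lineLength_eq {n a b c : ℕ} (ha : a ≤ n) (hb : b ≤ n) (hc : c ≤ n)
    (h : a + b + c = 2 * n + 1) :
    ∃ p : triangularBoard n,
      lineLength n 0 p = a ∧ lineLength n 1 p = b ∧ lineLength n 2 p = c := by
  refine ⟨⟨(a, n + 1 - b), mem_triangularBoard.2 ?_⟩, ?_⟩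
  · dsimp only; omega
  · simp [lineLength]; omega

/-- Lines of lengths `a` and `b` in two different directions meet if and only if
`n + 1 ≤ a + b`. -/
lemma exists_lineLength_iff {n a b : ℕ} {s t : Fin 3} (hst : s ≠ t) (ha : a ≤ n) (hb : b ≤ n) :
    (∃ p : triangularBoard n, lineLength n s p = a ∧ lineLength n t p = b) ↔ n + 1 ≤ a + b := by
  constructor
  · rintro ⟨p, h1, h2⟩
    have h := lineLength_sum p
    have h0 := lineLength_mem p 0
    have h1' := lineLength_mem p 1
    have h2' := lineLength_mem p 2
    fin_cases s <;> fin_cases t <;> simp at hst h1 h2 <;> omega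
  · intro h
    have hc : 2 * n + 1 - a - b ≤ n := by omega
    fin_cases s <;> fin_cases t <;> simp only [ne_eq, not_true_eq_false] at hst
    · obtain ⟨p, h0, h1, h2⟩ := exists_lineLength_eq ha hb hc (by omega)
      exact ⟨p, h0, h1⟩
    · obtain ⟨p, h0, h1, h2⟩ := exists_lineLength_eq ha hc hb (by omega)
      exact ⟨p, h0, h2⟩
    · obtain ⟨p, h0, h1, h2⟩ := exists_lineLength_eq hb ha hc (by omega)
      exact ⟨p, h1, h0⟩
    · obtain ⟨p, h0, h1, h2⟩ := exists_lineLength_eq hc ha hb (by omega)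
      exact ⟨p, h1, h2⟩
    · obtain ⟨p, h0, h1, h2⟩ := exists_lineLength_eq hb hc ha (by omega)
      exact ⟨p, h2, h0⟩
    · obtain ⟨p, h0, h1, h2⟩ := exists_lineLength_eq hc hb ha (by omega)
      exact ⟨p, h2, h1⟩

/-- The incidence matrix of lines against points.  The index `(a, s)` stands for the line of length
`a + 1` in direction `s`. -/
def lineIncidence (n : ℕ) : Matrix (Fin n × Fin 3) (triangularBoard n) ℝ :=
  of fun l p => if lineLength n l.2 p = l.1 + 1 then 1 else 0

/-- The matrix recording which lengths `a + 1`, `b + 1` belong to lines that meet, when the lines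
have different directions. -/
def lineOverlap (n : ℕ) : Matrix (Fin n) (Fin n) ℝ :=
  of fun a b => if n + 1 ≤ (a + 1 : ℕ) + (b + 1) then 1 else 0

/-- The diagonal matrix of the line lengths `1, …, n`. -/
def lengthMatrix (n : ℕ) : Matrix (Fin n) (Fin n) ℝ :=
  diagonal fun a => (a : ℝ) + 1

/-- Through each point passes exactly one line in each direction. -/
lemma sum_lineLength_indicator {n : ℕ} (s : Fin 3) (p : triangularBoard n) :
    ∑ a : Fin n, (if lineLength n s p = a + 1 then (1 : ℝ) else 0) = 1 := by
  have h := lineLength_mem p s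
  rw [Finset.sum_eq_single (⟨lineLength n s p - 1, by omega⟩ : Fin n)]
  · rw [if_pos]; dsimp only; omega
  · intro a _ ha
    rw [if_neg]
    intro h'
    exact ha (Fin.ext (by dsimp only; omega))
  · simp

lemma sum_lineIncidence_mul_of_ne {n : ℕ} {s t : Fin 3} (hst : s ≠ t) (a b : Fin n) :
    ∑ p, lineIncidence n (a, s) p * lineIncidence n (b, t) p = lineOverlap n a b := by
  have key := exists_lineLength_iff (n := n) (a := a + 1) (b := b + 1) hst (by omega) (by omega)
  simp only [lineIncidence, lineOverlap, of_apply, ite_mul, one_mul, zero_mul, ← ite_and]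
  split_ifs with h
  · obtain ⟨p, hp⟩ := key.2 h
    rw [Finset.sum_eq_single p]
    · rw [if_pos hp]
    · intro q _ hq
      rw [if_neg]
      intro hq'
      exact hq (eq_of_lineLength_eq hst (hq'.1.trans hp.1.symm) (hq'.2.trans hp.2.symm))
    · simp
  · refine Finset.sum_eq_zero fun p _ => if_neg fun hp => h (key.1 ⟨p, hp⟩)

lemma sum_lineOverlap (n : ℕ) (a : Fin n) : ∑ b, lineOverlap n a b = (a : ℝ) + 1 := by
  have : ((Finset.univ : Finset (Fin n)).filter
      fun b : Fin n => n + 1 ≤ (a + 1 : ℕ) + (b + 1)).card = a + 1 := by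
    have h : (Finset.univ : Finset (Fin n)).filter
        (fun b : Fin n => n + 1 ≤ (a + 1 : ℕ) + (b + 1)) =
        Finset.Ici ⟨n - 1 - a, by omega⟩ := by
      ext b
      simp only [Finset.mem_filter, Finset.mem_univ, true_and, Finset.mem_Ici, Fin.le_def]
      omega
    rw [h, Fin.card_Ici]
    dsimp only
    omega
  simp only [lineOverlap, of_apply, Finset.sum_boole, this]
  push_cast
  rfl

/-- A line of length `a + 1` has `a + 1` points: each lies on exactly one line of any other given
direction, so the points can be counted by the lines of that direction. -/
lemma sum_lineIncidence {n : ℕ} (s : Fin 3) (a : Fin n) :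
    ∑ p, lineIncidence n (a, s) p = (a : ℝ) + 1 := by
  have hst : s ≠ s + 1 := by fin_cases s <;> simp
  rw [← sum_lineOverlap, ← Finset.sum_congr rfl fun b _ => sum_lineIncidence_mul_of_ne hst a b,
    Finset.sum_comm]
  refine Finset.sum_congr rfl fun p _ => ?_
  rw [← Finset.mul_sum]
  simp only [lineIncidence, of_apply, sum_lineLength_indicator, mul_one]

lemma card_triangularBoard (n : ℕ) : (triangularBoard n).card = triangularNumber n := by
  have h : ((triangularBoard n).card : ℝ) = ∑ a : Fin n, ((a : ℝ) + 1) := by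
    rw [← Finset.sum_congr rfl fun a _ => sum_lineIncidence 0 a, Finset.sum_comm]
    simp only [lineIncidence, of_apply, sum_lineLength_indicator]
    simp
  rw [Fin.sum_univ_eq_sum_range fun a : ℕ => ((a : ℝ) + 1)] at h
  have h' : (triangularBoard n).card = ∑ a ∈ Finset.range n, (a + 1) := by exact_mod_cast h
  rw [h', triangularNumber, mul_comm n]
  have := Finset.sum_range_id_mul_two (n + 1)
  rw [Finset.sum_range_succ'] at this
  simp only [Nat.add_sub_cancel, add_zero] at this
  omega

/-- The Gram matrix of the points: two distinct points share one line if they are adjacent, and none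
otherwise. -/
lemma transpose_lineIncidence_mul (n : ℕ) :
    (lineIncidence n)ᵀ * lineIncidence n = (triangularGraph n).adjMatrix ℝ + scalar _ 3 := by
  ext p q
  have hsum : ((lineIncidence n)ᵀ * lineIncidence n) p q =
      ∑ s, if lineLength n s p = lineLength n s q then (1 : ℝ) else 0 := by
    rw [Matrix.mul_apply, Fintype.sum_prod_type, Finset.sum_comm]
    refine Finset.sum_congr rfl fun s _ => ?_
    simp only [lineIncidence, transpose_apply, of_apply]
    split_ifs with h
    · simp only [h]
      refine (Finset.sum_congr rfl fun a _ => ?_).trans (sum_lineLength_indicator s q)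
      split_ifs <;> simp
    · refine Finset.sum_eq_zero fun a _ => ?_
      split_ifs with h1 h2 <;> simp
      omega
  rw [hsum, Matrix.add_apply, SimpleGraph.adjMatrix_apply, scalar_apply, diagonal_apply]
  by_cases hpq : p = q
  · subst hpq; simp
  · have hp := mem_triangularBoard.1 p.2
    have hq := mem_triangularBoard.1 q.2
    have h01 := fun h h' => hpq (eq_of_lineLength_eq (s := 0) (t := 1) (by decide) h h')
    have h02 := fun h h' => hpq (eq_of_lineLength_eq (s := 0) (t := 2) (by decide) h h')
    have h12 := fun h h' => hpq (eq_of_lineLength_eq (s := 1) (t := 2) (by decide) h h')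
    have hadj : (triangularGraph n).Adj p q ↔ lineLength n 0 p = lineLength n 0 q ∨
        lineLength n 1 p = lineLength n 1 q ∨ lineLength n 2 p = lineLength n 2 q := by
      simp only [triangularGraph, ne_eq, hpq, not_false_eq_true, and_true, lineLength]
      simp
      omega
    simp only [hadj, if_neg hpq, Fin.sum_univ_three, add_zero]
    by_cases h0 : lineLength n 0 p = lineLength n 0 q <;>
    by_cases h1 : lineLength n 1 p = lineLength n 1 q <;>
    by_cases h2 : lineLength n 2 p = lineLength n 2 q <;>
    simp_all

open scoped Kronecker in
/-- The Gram matrix of the lines: whether two lines of different directions meet depends on their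
lengths only. -/
lemma lineIncidence_mul_transpose (n : ℕ) :
    lineIncidence n * (lineIncidence n)ᵀ =
      lengthMatrix n ⊗ₖ (1 : Matrix (Fin 3) (Fin 3) ℝ) +
        lineOverlap n ⊗ₖ (of fun s t => if s = t then 0 else 1) := by
  ext ⟨a, s⟩ ⟨b, t⟩
  simp only [Matrix.mul_apply, transpose_apply, Matrix.add_apply, kroneckerMap_apply, of_apply,
    one_apply]
  by_cases hst : s = t
  · subst hst
    by_cases hab : a = b
    · subst hab
      rw [if_pos rfl, if_pos rfl, lengthMatrix, diagonal_apply_eq, mul_one, mul_zero, add_zero,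
        ← sum_lineIncidence s a]
      refine Finset.sum_congr rfl fun p _ => ?_
      simp [lineIncidence]
    · rw [if_pos rfl, if_pos rfl, lengthMatrix, diagonal_apply_ne _ hab, zero_mul, mul_zero,
        add_zero]
      refine Finset.sum_eq_zero fun p _ => ?_
      simp only [lineIncidence, of_apply]
      split_ifs with h1 h2 <;> simp
      exact hab (Fin.ext (by omega))
  · rw [if_neg hst, if_neg hst, mul_zero, mul_one, zero_add, sum_lineIncidence_mul_of_ne hst]

/-! ### Splitting off the direction -/

open scoped Kronecker in
/-- The matrix `J - 1` of size three has eigenvalues `2, -1, -1`; diagonalizing it splits the Gram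
matrix of the lines into three blocks of size `n`. -/
lemma charpoly_kronecker_three {m : Type*} [Fintype m] [DecidableEq m] (D B : Matrix m m ℝ) :
    (D ⊗ₖ (1 : Matrix (Fin 3) (Fin 3) ℝ) +
        B ⊗ₖ (of fun s t : Fin 3 => if s = t then (0 : ℝ) else 1)).charpoly =
      (D + (2 : ℝ) • B).charpoly * (D + (-1 : ℝ) • B).charpoly ^ 2 := by
  set K : Matrix (Fin 3) (Fin 3) ℝ := of fun s t => if s = t then 0 else 1 with hK
  set R : Matrix (Fin 3) (Fin 3) ℝ := !![1, 1, 1; 1, -1, 0; 1, 0, -1] with hR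
  set L : Matrix (Fin 3) (Fin 3) ℝ :=
    !![1/3, 1/3, 1/3; 1/3, -2/3, 1/3; 1/3, 1/3, -2/3] with hL
  have hK' : K = !![0, 1, 1; 1, 0, 1; 1, 1, 0] := by
    ext i j
    fin_cases i <;> fin_cases j <;> simp [hK]
  have hLR : L * R = 1 := by
    rw [hL, hR, mul_fin_three, one_fin_three]
    norm_num
  have hLKR : L * K * R = diagonal ![2, -1, -1] := by
    rw [hL, hR, hK', mul_fin_three, mul_fin_three]
    norm_num
    ext i j
    fin_cases i <;> fin_cases j <;> simp
  have hRL : R * L = 1 := mul_eq_one_comm.1 hLR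
  have hconj : ((1 : Matrix m m ℝ) ⊗ₖ L) * (D ⊗ₖ (1 : Matrix (Fin 3) (Fin 3) ℝ) + B ⊗ₖ K) *
      ((1 : Matrix m m ℝ) ⊗ₖ R) =
      blockDiagonal fun s => D + (![2, -1, -1] s : ℝ) • B := by
    rw [mul_add, add_mul, ← mul_kronecker_mul, ← mul_kronecker_mul, ← mul_kronecker_mul,
      ← mul_kronecker_mul, hLKR]
    simp only [one_mul, mul_one, hLR]
    ext ⟨i, s⟩ ⟨j, t⟩
    by_cases h : s = t
    · subst h; simp [blockDiagonal_apply, kroneckerMap_apply, mul_comm]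
    · simp [blockDiagonal_apply, kroneckerMap_apply, h]
  have hblock : ∀ M : Fin 3 → Matrix m m ℝ,
      (blockDiagonal M).charpoly = ∏ s, (M s).charpoly := by
    intro M
    have : (blockDiagonal M).charmatrix = blockDiagonal fun s => (M s).charmatrix := by
      ext1 ⟨i, s⟩ ⟨j, t⟩
      by_cases h : s = t
      · subst h
        by_cases hij : i = j
        · subst hij; simp [blockDiagonal_apply]
        · simp [blockDiagonal_apply, hij]
      · simp [blockDiagonal_apply, h]
    rw [charpoly, this, det_blockDiagonal]
    rfl
  have h := congrArg Matrix.charpoly hconj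
  rw [Matrix.charpoly_mul_comm, ← mul_assoc, ← mul_kronecker_mul, hRL, one_mul,
    one_kronecker_one, one_mul, hblock, Fin.prod_univ_three] at h
  rw [h]
  simp [sq, mul_assoc]

/-! ### The eigenvalues of the two blocks -/

/-- A real square matrix with as many distinct integer eigenvalues as its size has no further
eigenvalues. -/
lemma roots_charpoly_eq_of_card {n : ℕ} (M : Matrix (Fin n) (Fin n) ℝ) (S : Finset ℤ)
    (hcard : S.card = n) (h : ∀ k ∈ S, (k : ℝ) ∈ M.charpoly.roots) :
    M.charpoly.roots = S.val.map fun k : ℤ => (k : ℝ) := by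
  symm
  apply Multiset.eq_of_le_of_card_le
  · rw [Multiset.le_iff_subset (S.nodup.map Int.cast_injective)]
    intro x hx
    obtain ⟨k, hk, rfl⟩ := Multiset.mem_map.1 hx
    exact h k hk
  · rw [Multiset.card_map, Finset.card_val, hcard]
    simpa using card_roots' M.charpoly

lemma sum_range_telescope_from (F : ℕ → ℝ) {c N : ℕ} (h : c ≤ N) :
    ∑ b ∈ Finset.range N, (if c ≤ b then F b - F (b + 1) else 0) = F c - F N := by
  induction N, h using Nat.le_induction with
  | base =>
    rw [sub_self]
    exact Finset.sum_eq_zero fun b hb => if_neg (by simpa using hb)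
  | succ N hN ih => rw [Finset.sum_range_succ, ih, if_pos hN]; ring

/-- A criterion for eigenvalues of `lengthMatrix n + t • lineOverlap n`.  The function `F` plays the
role of the tail sums of an eigenvector: in the coordinate of length `a` the vector is
`F a - F (a + 1)`, and applying `lineOverlap n` to it gives `F (n + 1 - a)`. -/
lemma mem_roots_of_tail {n : ℕ} {t μ : ℝ} (F : ℕ → ℝ) (hF : F (n + 1) = 0)
    (h : ∀ a b : ℕ, 1 ≤ a → 1 ≤ b → a + b = n + 1 →
      ((a : ℝ) - μ) * (F a - F (a + 1)) + t * F b = 0)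
    (hne : ∃ a, 1 ≤ a ∧ a ≤ n ∧ F a ≠ F (a + 1)) :
    μ ∈ (lengthMatrix n + t • lineOverlap n).charpoly.roots := by
  rw [mem_roots (charpoly_monic _).ne_zero, IsRoot, eval_charpoly,
    ← exists_mulVec_eq_zero_iff]
  refine ⟨fun a => F (a + 1) - F (a + 1 + 1), ?_, ?_⟩
  · obtain ⟨a, ha, han, hne⟩ := hne
    intro h0
    have := congrFun h0 ⟨a - 1, by omega⟩
    simp only [Pi.zero_apply, Nat.sub_add_cancel ha] at this
    exact hne (sub_eq_zero.1 this)
  · ext a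
    have hB : (lineOverlap n *ᵥ fun a : Fin n => F (a + 1) - F (a + 1 + 1)) a = F (n - a) := by
      simp only [mulVec, dotProduct, lineOverlap, of_apply, ite_mul, one_mul, zero_mul]
      rw [Fin.sum_univ_eq_sum_range fun b : ℕ =>
        if n + 1 ≤ (a + 1 : ℕ) + (b + 1) then F (b + 1) - F (b + 1 + 1) else 0]
      have := sum_range_telescope_from (fun b => F (b + 1)) (c := n - 1 - a) (N := n) (by omega)
      simp only [hF, sub_zero, show n - 1 - a + 1 = n - (a : ℕ) by omega] at this
      rw [← this]
      refine Finset.sum_congr rfl fun b _ => if_congr (by omega) rfl rfl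
    have ha := h (a + 1) (n - a) (by omega) (by omega) (by omega)
    rw [sub_mulVec, add_mulVec, smul_mulVec, Pi.sub_apply, Pi.add_apply, Pi.smul_apply, hB]
    simp only [lengthMatrix, scalar_apply, mulVec_diagonal, smul_eq_mul, Pi.zero_apply]
    push_cast at ha
    linarith

/-- If `2 * k < n`, the eigenvector is `1` on the lengths in `(k, n - k]`; if `2 * k > n + 1`, it is
`-1` on the lengths in `[n + 1 - k, k)`.  The entry at `k` makes the total `0` (there is no such
entry for `k = 0`, where the vector is constant), and all other entries vanish. -/
lemma mem_roots_sub_overlap {n k : ℕ} (hk : k ≤ n) (h : 2 * k + 1 ≤ n ∨ n + 2 ≤ 2 * k) :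
    (k : ℝ) ∈ (lengthMatrix n + (-1 : ℝ) • lineOverlap n).charpoly.roots := by
  rcases h with h | h
  · apply mem_roots_of_tail fun m => if k < m ∧ m + k ≤ n + 1 then (n : ℝ) + 1 - k - m else 0
    · split_ifs with h0
      · obtain rfl : k = 0 := by omega
        push_cast; ring
      · rfl
    · intro a b ha hb hab
      have hb' : (b : ℝ) = n + 1 - a := by rw [eq_sub_iff_add_eq']; exact_mod_cast hab
      rcases lt_trichotomy a k with hak | rfl | hak
      · rw [if_neg (by omega), if_neg (by omega), if_neg (by omega)]; ring
      · split_ifs <;> first | omega | (rw [hb']; ring)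
      · by_cases hak' : a + k ≤ n
        · rw [if_pos (by omega), if_pos (by omega), if_pos (by omega), hb']; push_cast; ring
        · by_cases hak'' : a + k = n + 1
          · have : (n : ℝ) = a + k - 1 := by rw [eq_sub_iff_add_eq]; exact_mod_cast hak''.symm
            rw [if_pos (by omega), if_neg (by omega), if_neg (by omega), this]; ring
          · rw [if_neg (by omega), if_neg (by omega), if_neg (by omega)]; ring
    · refine ⟨n - k, by omega, by omega, ?_⟩
      rw [if_pos (by omega), if_pos (by omega)]
      push_cast
      intro h'
      linarith
  · apply mem_roots_of_tail fun m => if n + 1 ≤ m + k ∧ m ≤ k then (m : ℝ) + k - n - 1 else 0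
    · rw [if_neg (by omega)]
    · intro a b ha hb hab
      have hb' : (b : ℝ) = n + 1 - a := by rw [eq_sub_iff_add_eq']; exact_mod_cast hab
      rcases lt_trichotomy a k with hak | rfl | hak
      · by_cases hak' : n + 1 ≤ a + k
        · rw [if_pos (by omega), if_pos (by omega), if_pos (by omega), hb']; push_cast; ring
        · by_cases hak'' : a + k = n
          · have : (n : ℝ) = a + k := by exact_mod_cast hak''.symm
            rw [if_neg (by omega), if_pos (by omega), if_neg (by omega), this]; push_cast; ring
          · rw [if_neg (by omega), if_neg (by omega), if_neg (by omega)]; ring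
      · rw [if_pos (c := n + 1 ≤ b + a ∧ b ≤ a) (by omega), hb']; ring
      · rw [if_neg (by omega), if_neg (by omega), if_neg (by omega)]; ring
    · refine ⟨k, by omega, hk, ?_⟩
      rw [if_pos (by omega), if_neg (by omega)]
      have : (n : ℝ) + 2 ≤ 2 * k := by exact_mod_cast h
      intro h'
      linarith

/-- The eigenvectors live on the same intervals as in `mem_roots_sub_overlap`, again balanced by the
entry at `k`.  On the interval the entry of length `a` is proportional to
`3 * a - (2 * n + 1 - k)`, which makes the tail sums quadratic. -/
lemma mem_roots_add_overlap {n k : ℕ} (hk : k ≤ n) (h : 2 * k + 2 ≤ n ∨ n + 3 ≤ 2 * k) :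
    (k : ℝ) ∈ (lengthMatrix n + (2 : ℝ) • lineOverlap n).charpoly.roots := by
  rcases h with h | h
  · apply mem_roots_of_tail fun m => if k < m ∧ m + k ≤ n + 1 then
      ((n : ℝ) + 1 - k - m) * (3 * m - n - k - 2) else 0
    · split_ifs with h0
      · obtain rfl : k = 0 := by omega
        push_cast; ring
      · rfl
    · intro a b ha hb hab
      have hb' : (b : ℝ) = n + 1 - a := by rw [eq_sub_iff_add_eq']; exact_mod_cast hab
      rcases lt_trichotomy a k with hak | rfl | hak
      · rw [if_neg (by omega), if_neg (by omega), if_neg (by omega)]; ring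
      · split_ifs <;> first | omega | (rw [hb']; ring)
      · by_cases hak' : a + k ≤ n
        · rw [if_pos (by omega), if_pos (by omega), if_pos (by omega), hb']; push_cast; ring
        · by_cases hak'' : a + k = n + 1
          · have : (n : ℝ) = a + k - 1 := by rw [eq_sub_iff_add_eq]; exact_mod_cast hak''.symm
            rw [if_pos (by omega), if_neg (by omega), if_neg (by omega), this]; ring
          · rw [if_neg (by omega), if_neg (by omega), if_neg (by omega)]; ring
    · refine ⟨n - k, by omega, by omega, ?_⟩
      rw [if_pos (by omega), if_pos (by omega)]
      have : (2 : ℝ) * k + 2 ≤ n := by exact_mod_cast h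
      push_cast [Nat.cast_sub hk]
      intro h'
      linarith
  · apply mem_roots_of_tail fun m => if n + 1 ≤ m + k ∧ m ≤ k then
      ((m : ℝ) + k - n - 1) * (3 * m - n - k - 2) else 0
    · rw [if_neg (by omega)]
    · intro a b ha hb hab
      have hb' : (b : ℝ) = n + 1 - a := by rw [eq_sub_iff_add_eq']; exact_mod_cast hab
      rcases lt_trichotomy a k with hak | rfl | hak
      · by_cases hak' : n + 1 ≤ a + k
        · rw [if_pos (by omega), if_pos (by omega), if_pos (by omega), hb']; push_cast; ring
        · by_cases hak'' : a + k = n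
          · have : (n : ℝ) = a + k := by exact_mod_cast hak''.symm
            rw [if_neg (by omega), if_pos (by omega), if_neg (by omega), this]; push_cast; ring
          · rw [if_neg (by omega), if_neg (by omega), if_neg (by omega)]; ring
      · rw [if_pos (c := n + 1 ≤ b + a ∧ b ≤ a) (by omega), hb']; ring
      · rw [if_neg (by omega), if_neg (by omega), if_neg (by omega)]; ring
    · refine ⟨k, by omega, hk, ?_⟩
      rw [if_pos (by omega), if_neg (by omega)]
      have : (n : ℝ) + 3 ≤ 2 * k := by exact_mod_cast h
      exact mul_ne_zero (by linarith) (by linarith)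

/-- The eigenvector is `a ↦ a`. -/
lemma two_mul_add_one_mem_roots_add_overlap {n : ℕ} (hn : 1 ≤ n) :
    (2 * n + 1 : ℝ) ∈ (lengthMatrix n + (2 : ℝ) • lineOverlap n).charpoly.roots := by
  apply mem_roots_of_tail fun m => ((n : ℝ) - m + 1) * (n + m) / 2
  · push_cast; ring
  · intro a b ha hb hab
    have : (n : ℝ) = a + b - 1 := by rw [eq_sub_iff_add_eq]; exact_mod_cast hab.symm
    rw [this]; push_cast; ring
  · exact ⟨n, hn, le_rfl, by push_cast; ring_nf; positivity⟩

/-- The eigenvalues of `lengthMatrix n - lineOverlap n`. -/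
noncomputable def subOverlapEigenvalues (n : ℕ) : Finset ℤ :=
  (Finset.Icc 0 (n : ℤ)).erase (((n : ℤ) + 1) / 2)

/-- The eigenvalues of `lengthMatrix n + 2 • lineOverlap n`. -/
noncomputable def addOverlapEigenvalues (n : ℕ) : Finset ℤ :=
  insert (2 * (n : ℤ) + 1) (((Finset.Icc 0 (n : ℤ)).erase ((n : ℤ) / 2)).erase ((n : ℤ) / 2 + 1))

lemma roots_sub_overlap (n : ℕ) :
    (lengthMatrix n + (-1 : ℝ) • lineOverlap n).charpoly.roots =
      (subOverlapEigenvalues n).val.map fun k : ℤ => (k : ℝ) := by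
  apply roots_charpoly_eq_of_card
  · rw [subOverlapEigenvalues, Finset.card_erase_of_mem (by rw [Finset.mem_Icc]; omega),
      Int.card_Icc]
    omega
  · intro k hk
    simp only [subOverlapEigenvalues, Finset.mem_erase, Finset.mem_Icc] at hk
    lift k to ℕ using hk.2.1
    exact mem_roots_sub_overlap (by omega) (by omega)

lemma roots_add_overlap {n : ℕ} (hn : 1 ≤ n) :
    (lengthMatrix n + (2 : ℝ) • lineOverlap n).charpoly.roots =
      (addOverlapEigenvalues n).val.map fun k : ℤ => (k : ℝ) := by
  apply roots_charpoly_eq_of_card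
  · rw [addOverlapEigenvalues, Finset.card_insert_of_notMem, Finset.card_erase_of_mem,
      Finset.card_erase_of_mem, Int.card_Icc]
    · omega
    all_goals simp only [Finset.mem_erase, Finset.mem_Icc]; omega
  · intro k hk
    simp only [addOverlapEigenvalues, Finset.mem_insert, Finset.mem_erase, Finset.mem_Icc] at hk
    rcases hk with rfl | hk
    · exact_mod_cast two_mul_add_one_mem_roots_add_overlap hn
    · lift k to ℕ using hk.2.2.1
      exact mem_roots_add_overlap (by omega) (by omega)

/-! ### The spectrum -/

/-- The product of a rectangular matrix with its transpose, in either order, has the same nonzero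
spectrum; the surplus dimensions on the two sides are made up by zeros. -/
lemma graphSpectrum_triangularGraph_shift {n : ℕ} (hn : 1 ≤ n) :
    Multiset.replicate (3 * n) (0 : ℝ) + (graphSpectrum (triangularGraph n)).map (· + 3) =
      Multiset.replicate (triangularNumber n) 0 +
        ((addOverlapEigenvalues n).val.map (fun k : ℤ => (k : ℝ)) +
          2 • (subOverlapEigenvalues n).val.map (fun k : ℤ => (k : ℝ))) := by
  have hshift : ((lineIncidence n)ᵀ * lineIncidence n).charpoly.roots =
      (graphSpectrum (triangularGraph n)).map (· + 3) := by
    have h := charpoly_sub_scalar ((lineIncidence n)ᵀ * lineIncidence n) 3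
    rw [transpose_lineIncidence_mul, add_sub_cancel_right, ← transpose_lineIncidence_mul] at h
    have h' := map_roots_comp_C_mul_X_add_C ((lineIncidence n)ᵀ * lineIncidence n).charpoly
      1 3 isUnit_one
    rw [graphSpectrum, h, ← h']
    simp
  have hgram := Matrix.charpoly_mul_comm' (lineIncidence n) (lineIncidence n)ᵀ
  rw [lineIncidence_mul_transpose, charpoly_kronecker_three] at hgram
  have hroots := congrArg Polynomial.roots hgram
  have hX : ∀ m : ℕ, (X ^ m : ℝ[X]) ≠ 0 := fun m => pow_ne_zero _ X_ne_zero
  have hM : ∀ {m : Type} [Fintype m] [DecidableEq m] (M : Matrix m m ℝ), M.charpoly ≠ 0 :=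
    fun M => (charpoly_monic M).ne_zero
  rw [roots_mul (mul_ne_zero (hX _) (mul_ne_zero (hM _) (pow_ne_zero _ (hM _)))),
    roots_mul (mul_ne_zero (hM _) (pow_ne_zero _ (hM _))), roots_mul (mul_ne_zero (hX _) (hM _)),
    roots_X_pow, roots_X_pow, roots_pow, roots_sub_overlap, roots_add_overlap hn, hshift] at hroots
  simpa [Multiset.nsmul_singleton, card_triangularBoard, mul_comm] using hroots.symm

/-- To identify the spectrum with a multiset of integers it suffices to compare multisets of
integers after the shift by `3`. -/
lemma graphSpectrum_triangularGraph_eq {n : ℕ} (hn : 1 ≤ n) (Z : Multiset ℤ)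
    (h : Multiset.replicate (3 * n) 0 + Z.map (· + 3) =
      Multiset.replicate (triangularNumber n) 0 +
        ((addOverlapEigenvalues n).val + 2 • (subOverlapEigenvalues n).val)) :
    graphSpectrum (triangularGraph n) = Z.map fun k : ℤ => (k : ℝ) := by
  have h1 := graphSpectrum_triangularGraph_shift hn
  have h2 := congrArg (Multiset.map fun k : ℤ => (k : ℝ)) h
  simp only [Multiset.map_add, Multiset.map_replicate, Multiset.map_nsmul, Int.cast_zero] at h2
  rw [← h2] at h1
  apply Multiset.map_injective (add_left_injective (3 : ℝ))
  rw [add_left_cancel h1, Multiset.map_map, Multiset.map_map]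
  simp

lemma count_Icc (a b y : ℤ) :
    (Finset.Icc a b).val.count y = if a ≤ y ∧ y ≤ b then 1 else 0 := by
  rw [Multiset.count_eq_of_nodup (Finset.nodup _)]
  simp only [Finset.mem_val, Finset.mem_Icc]

lemma triangularNumber_sub_three {n : ℕ} (hn : 3 ≤ n) :
    triangularNumber n + 3 = triangularNumber (n - 3) + 3 * n := by
  obtain ⟨m, rfl⟩ := Nat.exists_eq_add_of_le' hn
  simp only [triangularNumber, Nat.add_sub_cancel]
  have : (m + 3) * (m + 3 + 1) = m * (m + 1) + 2 * (3 * m + 6) := by ring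
  omega

lemma graphSpectrum_triangularGraph_of_odd {n : ℕ} (hn : 3 ≤ n) (hodd : Odd n) :
    graphSpectrum (triangularGraph n) =
      ({2 * (n : ℤ) - 2} + 3 • (Finset.Icc (((n : ℤ) - 3) / 2) ((n : ℤ) - 3)).val
        + Multiset.replicate 2 (((n : ℤ) - 7) / 2)
        + 3 • (Finset.Icc (-2) (((n : ℤ) - 9) / 2)).val
        + Multiset.replicate (triangularNumber (n - 3)) (-3) : Multiset ℤ).map
          fun k : ℤ => (k : ℝ) := by
  apply graphSpectrum_triangularGraph_eq (by omega)
  have hT := triangularNumber_sub_three hn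
  generalize triangularNumber (n - 3) = T at hT ⊢
  obtain ⟨m, hm⟩ := hodd
  ext y
  obtain ⟨x, rfl⟩ : ∃ x, y = x + 3 := ⟨y - 3, by ring⟩
  rw [Multiset.count_add, Multiset.count_map_eq_count' _ _ (add_left_injective 3)]
  simp only [Multiset.count_add, Multiset.count_nsmul, count_Icc, Multiset.count_replicate,
    Multiset.count_singleton, addOverlapEigenvalues, subOverlapEigenvalues]
  rw [Multiset.count_eq_of_nodup (Finset.nodup _), Multiset.count_eq_of_nodup (Finset.nodup _)]
  simp only [Finset.mem_val, Finset.mem_insert, Finset.mem_erase, Finset.mem_Icc]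
  split_ifs <;> omega

lemma graphSpectrum_triangularGraph_of_even {n : ℕ} (hn : 4 ≤ n) (heven : Even n) :
    graphSpectrum (triangularGraph n) =
      ({2 * (n : ℤ) - 2} + 3 • (Finset.Icc (((n : ℤ) - 2) / 2) ((n : ℤ) - 3)).val
        + Multiset.replicate 2 (((n : ℤ) - 4) / 2)
        + 3 • (Finset.Icc (-2) (((n : ℤ) - 8) / 2)).val
        + Multiset.replicate (triangularNumber (n - 3)) (-3) : Multiset ℤ).map
          fun k : ℤ => (k : ℝ) := by
  apply graphSpectrum_triangularGraph_eq (by omega)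
  have hT := triangularNumber_sub_three (by omega : 3 ≤ n)
  generalize triangularNumber (n - 3) = T at hT ⊢
  obtain ⟨m, hm⟩ := heven
  ext y
  obtain ⟨x, rfl⟩ : ∃ x, y = x + 3 := ⟨y - 3, by ring⟩
  rw [Multiset.count_add, Multiset.count_map_eq_count' _ _ (add_left_injective 3)]
  simp only [Multiset.count_add, Multiset.count_nsmul, count_Icc, Multiset.count_replicate,
    Multiset.count_singleton, addOverlapEigenvalues, subOverlapEigenvalues]
  rw [Multiset.count_eq_of_nodup (Finset.nodup _), Multiset.count_eq_of_nodup (Finset.nodup _)]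
  simp only [Finset.mem_val, Finset.mem_insert, Finset.mem_erase, Finset.mem_Icc]
  split_ifs <;> omega

/-- Boards with at most two rows have all their points pairwise collinear. -/
lemma triangularGraph_eq_top {n : ℕ} (hn : n ≤ 2) : triangularGraph n = ⊤ := by
  ext p q
  have hp := mem_triangularBoard.1 p.2
  have hq := mem_triangularBoard.1 q.2
  simp only [triangularGraph, SimpleGraph.top_adj, and_iff_right_iff_imp]
  omega

theorem theorem3 :
    (∀ n : ℕ, n = 1 ∨ n = 2 →
      Nonempty (triangularGraph n ≃g (⊤ : SimpleGraph (Fin (triangularNumber n))))) ∧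
    graphSpectrum (triangularGraph 3) =
      {(4 : ℝ)} + Multiset.replicate 3 (0 : ℝ) + Multiset.replicate 2 (-2 : ℝ) ∧
    (∀ n : ℕ, 4 ≤ n →
      IsIntegralGraph (triangularGraph n) ∧
      (Odd n →
        graphSpectrum (triangularGraph n) =
          {2 * (n : ℝ) - 2}
          + integerRange 3 (((n : ℤ) - 3) / 2) ((n : ℤ) - 3)
          + Multiset.replicate 2 (((n : ℝ) - 7) / 2)
          + integerRange 3 (-2) (((n : ℤ) - 9) / 2)
          + Multiset.replicate (triangularNumber (n - 3)) (-3 : ℝ)) ∧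
      (Even n →
        graphSpectrum (triangularGraph n) =
          {2 * (n : ℝ) - 2}
          + integerRange 3 (((n : ℤ) - 2) / 2) ((n : ℤ) - 3)
          + Multiset.replicate 2 (((n : ℝ) - 4) / 2)
          + integerRange 3 (-2) (((n : ℤ) - 8) / 2)
          + Multiset.replicate (triangularNumber (n - 3)) (-3 : ℝ))) := by
  refine ⟨fun n hn => ?_, ?_, fun n hn => ⟨?_, fun hodd => ?_, fun heven => ?_⟩⟩
  · rw [triangularGraph_eq_top (by omega)]
    exact ⟨SimpleGraph.Iso.completeGraph
      (Fintype.equivFinOfCardEq (by rw [Fintype.card_coe, card_triangularBoard]))⟩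
  · rw [graphSpectrum_triangularGraph_of_odd le_rfl (by decide)]
    norm_num [triangularNumber, Multiset.map_nsmul, Multiset.nsmul_singleton]
  · rcases Nat.even_or_odd n with h | h
    · rw [IsIntegralGraph, graphSpectrum_triangularGraph_of_even hn h]
      intro μ hμ
      obtain ⟨k, -, rfl⟩ := Multiset.mem_map.1 hμ
      exact ⟨k, rfl⟩
    · rw [IsIntegralGraph, graphSpectrum_triangularGraph_of_odd (by omega) h]
      intro μ hμ
      obtain ⟨k, -, rfl⟩ := Multiset.mem_map.1 hμ
      exact ⟨k, rfl⟩
  · have h : ((((n : ℤ) - 7) / 2 : ℤ) : ℝ) = ((n : ℝ) - 7) / 2 := by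
      obtain ⟨m, hm⟩ := hodd
      rw [show ((n : ℤ) - 7) / 2 = m - 3 by omega, hm]
      push_cast
      ring
    rw [graphSpectrum_triangularGraph_of_odd (by omega) hodd, ← h]
    simp [integerRange, Multiset.map_nsmul]
  · have h : ((((n : ℤ) - 4) / 2 : ℤ) : ℝ) = ((n : ℝ) - 4) / 2 := by
      obtain ⟨m, hm⟩ := heven
      rw [show ((n : ℤ) - 4) / 2 = m - 2 by omega, hm]
      push_cast
      ring
    rw [graphSpectrum_triangularGraph_of_even hn heven, ← h]
    simp [integerRange, Multiset.map_nsmul]
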